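/- Let $(\Omega,\mathscr F,\mathsf P)$ be a probability space and $\gamma:\Omega\to[0,+\infty]$ a random variable with $\mathsf P(\gamma>0)>0$. For $t\in\mathbb R_+=[0,\infty)$ let $\mathscr F_t$ be the collection of all $A\in\mathscr F$ such that $A\cap\{t<\gamma\}$ is either $\varnothing$ or $\{t<\gamma\}$; then $\mathbb F=(\mathscr F_t)_{t\in\mathbb R_+}$ is a right-continuous (not necessarily complete) filtration, the single jump filtration generated by $\gamma$ and $\mathscr F$. A local martingale is an $\mathbb F$-adapted real-valued process $M=(M_t)_{t\in\mathbb R_+}$ with almost all paths càdlàg (right-continuous with finite left-hand limits) for which there are $\mathbb F$-stopping times $T_n$, almost surely increasing to $+\infty$, such that each stopped process $M^{T_n}=(M_{t\wedge T_n})_{t\in\mathbb R_+}$ is a uniformly integrable $\mathbb F$-martingale (in particular, $M_0$ is integrable). Then every local martingale $M$ has a decomposition $$M=M'+M''$$ into two local martingales $M'$ and $M''$ such that $M'$ is adapted to the smallest right-continuous filtration making $\gamma$ a stopping time, and $M''$ vanishes on $\{(\omega,t): t<\gamma(\omega)\}$ and satisfies $\mathsf E M''_0=0$. Both the equality $M=M'+M''$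 and the vanishing of $M''$ can be achieved identically in $(\omega,t)$. The decomposition is unique up to indistinguishability, even among decompositions in which these two properties are required only up to evanescent sets; that is, only for all $t$ simultaneously outside a $\mathsf P$-null set of $\omega$. -/

import Mathlib

open MeasureTheory ProbabilityTheory Filter Topology
open scoped NNReal ENNReal

namespace SingleJump

/-- The single jump filtration generated by `γ` and the ambient `σ`-field: `A` belongs to the
`σ`-field at time `t` if `A` is an event and `A ∩ {t < γ}` is either empty or all of `{t < γ}`. -/
def singleJumpFiltration {Ω : Type*} {mΩ : MeasurableSpace Ω} (γ : Ω → ℝ≥0∞) :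
    Filtration ℝ≥0 mΩ where
  seq t :=
    { MeasurableSet' := fun A => MeasurableSet A ∧
        (A ∩ {ω | (t : ℝ≥0∞) < γ ω} = ∅ ∨ A ∩ {ω | (t : ℝ≥0∞) < γ ω} = {ω | (t : ℝ≥0∞) < γ ω})
      measurableSet_empty := ⟨MeasurableSet.empty, Or.inl (Set.empty_inter _)⟩
      measurableSet_compl := by
        rintro A ⟨hA, h⟩
        refine ⟨hA.compl, ?_⟩
        rcases h with h | h
        · right
          ext ω
          have := Set.ext_iff.1 h ω
          simp only [Set.mem_inter_iff, Set.mem_ofPred_eq, Set.mem_compl_iff,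
            Set.mem_empty_iff_false, iff_false] at this ⊢
          tauto
        · left
          ext ω
          have := Set.ext_iff.1 h ω
          simp only [Set.mem_inter_iff, Set.mem_ofPred_eq, Set.mem_compl_iff,
            Set.mem_empty_iff_false, iff_false] at this ⊢
          tauto
      measurableSet_iUnion := by
        intro f hf
        refine ⟨MeasurableSet.iUnion fun i => (hf i).1, ?_⟩
        by_cases h : ∃ i, f i ∩ {ω | (t : ℝ≥0∞) < γ ω} = {ω | (t : ℝ≥0∞) < γ ω}
        · obtain ⟨i, hi⟩ := h
          right
          refine Set.inter_eq_right.2 ?_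
          exact (Set.inter_eq_right.1 hi).trans (Set.subset_iUnion f i)
        · left
          rw [Set.iUnion_inter]
          refine Set.iUnion_eq_empty.2 fun i => ?_
          exact (hf i).2.resolve_right fun hi => h ⟨i, hi⟩ }
  mono' := by
    rintro s t hst A ⟨hA, h⟩
    have hsub : {ω | (t : ℝ≥0∞) < γ ω} ⊆ {ω | (s : ℝ≥0∞) < γ ω} := fun ω hω =>
      lt_of_le_of_lt (ENNReal.coe_le_coe.2 hst) hω
    refine ⟨hA, ?_⟩
    rcases h with h | h
    · left
      exact Set.subset_empty_iff.1 (h ▸ Set.inter_subset_inter_right A hsub)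
    · right
      exact Set.inter_eq_right.2 (hsub.trans (Set.inter_eq_right.1 h))
  le' := fun _ _ hA => hA.1

/-- The single jump filtration is right-continuous. -/
theorem isRightContinuous_singleJumpFiltration {Ω : Type*} {mΩ : MeasurableSpace Ω}
    (γ : Ω → ℝ≥0∞) : (singleJumpFiltration (mΩ := mΩ) γ).IsRightContinuous := by
  refine ⟨fun t A hA => ?_⟩
  rw [Filtration.rightCont_eq] at hA
  simp only [MeasurableSpace.measurableSet_iInf] at hA
  refine ⟨(hA (t + 1) (by simp)).1, ?_⟩
  rcases Set.eq_empty_or_nonempty (A ∩ {ω | (t : ℝ≥0∞) < γ ω}) with h | ⟨ω₀, hω₀, ht₀⟩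
  · exact Or.inl h
  · right
    refine Set.inter_eq_right.2 fun ω hω => ?_
    obtain ⟨q, hq, hq'⟩ := ENNReal.lt_iff_exists_nnreal_btwn.1 (lt_min ht₀ hω)
    have hq₀ : (q : ℝ≥0∞) < γ ω₀ := hq'.trans_le (min_le_left _ _)
    rcases (hA q (ENNReal.coe_lt_coe.1 hq)).2 with h | h
    · exact absurd (show ω₀ ∈ A ∩ {ω | (q : ℝ≥0∞) < γ ω} from ⟨hω₀, hq₀⟩) (by simp [h])
    · exact Set.inter_eq_right.1 h (hq'.trans_le (min_le_right _ _))

/-- The smallest filtration (that is, the smallest right-continuous increasing family of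
sub-`σ`-fields) for which `γ` is a stopping time. -/
noncomputable def smallestFiltration {Ω : Type*} {mΩ : MeasurableSpace Ω} (γ : Ω → ℝ≥0∞) :
    Filtration ℝ≥0 mΩ :=
  sInf {𝓗 : Filtration ℝ≥0 mΩ | 𝓗.IsRightContinuous ∧ IsStoppingTime 𝓗 γ}

/-- The infimum in the definition of `smallestFiltration` is attained. -/
theorem isLeast_smallestFiltration {Ω : Type*} {mΩ : MeasurableSpace Ω} {γ : Ω → ℝ≥0∞}
    (hγ : Measurable γ) :
    IsLeast {𝓗 : Filtration ℝ≥0 mΩ | 𝓗.IsRightContinuous ∧ IsStoppingTime 𝓗 γ}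
      (smallestFiltration γ) := by
  have hne : {𝓗 : Filtration ℝ≥0 mΩ | 𝓗.IsRightContinuous ∧ IsStoppingTime 𝓗 γ}.Nonempty := by
    refine ⟨singleJumpFiltration γ, isRightContinuous_singleJumpFiltration γ, fun t => ?_⟩
    have h1 : MeasurableSet {ω | γ ω ≤ (t : ℝ≥0∞)} := measurableSet_le hγ measurable_const
    have h2 : {ω | γ ω ≤ (t : ℝ≥0∞)} ∩ {ω | (t : ℝ≥0∞) < γ ω} = ∅ :=
      Set.eq_empty_of_forall_notMem fun ω hω => absurd (show (t : ℝ≥0∞) < γ ω from hω.2) (not_lt_of_ge hω.1)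
    exact ⟨h1, Or.inl h2⟩
  have hglb := isGLB_sInf {𝓗 : Filtration ℝ≥0 mΩ | 𝓗.IsRightContinuous ∧ IsStoppingTime 𝓗 γ}
  refine ⟨⟨⟨?_⟩, fun t => ?_⟩, hglb.1⟩
  · refine hglb.2 fun 𝓗 h𝓗 => ?_
    refine le_trans (fun t => ?_) h𝓗.1.RC
    rw [Filtration.rightCont_eq, Filtration.rightCont_eq]
    exact iInf₂_mono fun s _ => hglb.1 h𝓗 s
  · rw [smallestFiltration, Filtration.sInf_def, if_pos hne]
    simp only [MeasurableSpace.measurableSet_sInf, Set.forall_mem_image]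
    exact fun 𝓗 h𝓗 => h𝓗.2 t

/-- Right-continuous at every `t ≥ 0` with a finite left-hand limit at every `t > 0`. -/
def IsCadlag (f : ℝ≥0 → ℝ) : Prop :=
  (∀ t, ContinuousWithinAt f (Set.Ici t) t) ∧
    ∀ t, 0 < t → ∃ l : ℝ, Tendsto f (𝓝[<] t) (𝓝 l)

/-- An adapted process with almost all paths càdlàg for which there are stopping times `τ n`, almost
surely increasing to infinity, such that every stopped process is a uniformly integrable
martingale. -/
def IsLocalMartingale {Ω : Type*} {mΩ : MeasurableSpace Ω} (M : ℝ≥0 → Ω → ℝ)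
    (𝓕 : Filtration ℝ≥0 mΩ) (P : Measure Ω) : Prop :=
  StronglyAdapted 𝓕 M ∧
  (∀ᵐ ω ∂P, IsCadlag fun t => M t ω) ∧
  ∃ τ : ℕ → Ω → WithTop ℝ≥0, IsLocalizingSequence 𝓕 τ P ∧
    ∀ n, Martingale (stoppedProcess M (τ n)) 𝓕 P ∧
      UniformIntegrable (stoppedProcess M (τ n)) 1 P

/-- The processes differ on an evanescent set. -/
def Indistinguishable {Ω : Type*} {mΩ : MeasurableSpace Ω} (P : Measure Ω)
    (X Y : ℝ≥0 → Ω → ℝ) : Prop :=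
  ∀ᵐ ω ∂P, ∀ t, X t ω = Y t ω

/-- `M = M' + M''` up to indistinguishability, where `M'` and `M''` are local martingales with
respect to the single jump filtration, `M'` is adapted to the smallest filtration making `γ` a
stopping time, and `M''` vanishes on `{t < γ}` up to an evanescent set and satisfies
`𝔼 M''₀ = 0`. -/
structure IsDecomposition {Ω : Type*} {mΩ : MeasurableSpace Ω} (P : Measure Ω) (γ : Ω → ℝ≥0∞)
    (M M' M'' : ℝ≥0 → Ω → ℝ) : Prop where
  sum_eq : Indistinguishable P M (M' + M'')
  localMartingale_fst : IsLocalMartingale M' (singleJumpFiltration γ) P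
  localMartingale_snd : IsLocalMartingale M'' (singleJumpFiltration γ) P
  adapted_fst : StronglyAdapted (smallestFiltration (mΩ := mΩ) γ) M'
  vanish_snd : ∀ᵐ ω ∂P, ∀ t : ℝ≥0, (t : ℝ≥0∞) < γ ω → M'' t ω = 0
  integrable_snd : Integrable (M'' 0) P
  expectation_snd : ∫ ω, M'' 0 ω ∂P = 0

end SingleJump

/-! Measurability at time `t` means measurability plus constancy on `{t < γ}`, so an adapted process
is deterministic before `γ`. A local martingale is frozen after `γ`, because every event inside `{γ
≤ s}` is already known at time `s`. Hence `M` is a deterministic function before `γ` and a random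
variable `L` from `γ` on (`IsLocalMartingale.ae_eq_valueAfter`). The part `M'` replaces `L` by its
conditional mean `H(γ)` given `γ`, and `M'' = (L - H(γ)) 1{γ ≤ t}`.

`L` need not be integrable, so `H` comes from the conditional distribution and is used only on
events `{γ ∈ S}` where `L` is integrable. Localization supplies these, since `{γ ≤ τ}` has this form
for every stopping time `τ`. On such events `M'` stopped at `τ` is the conditional expectation given
`γ` of `M` stopped at `τ` (`stoppedProcess_meanPart_ae_eq_condExp`). This gives the martingale
property and uniform integrability, so one localizing sequence serves `M`, `M'` and `M''`.

For uniqueness, a second part that vanishes before `γ` and has mean zero has a terminal value whose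
integrals over the events `{γ ≤ x}` vanish locally, so its conditional mean given `γ` is zero. The
terminal value of the first part is a function of `γ`, hence equals `H(γ)`. -/

namespace SingleJump

/-! ### Stopping times and measurability in the two filtrations. -/

section Filtration

variable {Ω : Type*} {mΩ : MeasurableSpace Ω} {γ : Ω → ℝ≥0∞}

/-- A function is measurable at time `t` for the single jump filtration iff it is measurable and
constant on `{t < γ}`. -/
theorem stronglyMeasurable_singleJumpFiltration_iff {t : ℝ≥0} {f : Ω → ℝ} :
    StronglyMeasurable[singleJumpFiltration (mΩ := mΩ) γ t] f ↔
      Measurable f ∧ ∀ ω ω', (t : ℝ≥0∞) < γ ω → (t : ℝ≥0∞) < γ ω' → f ω = f ω' := by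
  constructor
  · intro hf
    refine ⟨(hf.mono ((singleJumpFiltration γ).le t)).measurable, fun ω ω' hω hω' => ?_⟩
    have h : MeasurableSet[singleJumpFiltration (mΩ := mΩ) γ t] (f ⁻¹' {f ω}) :=
      hf.measurable (measurableSet_singleton _)
    rcases h.2 with h | h
    · exact absurd (show ω ∈ f ⁻¹' {f ω} ∩ {ω | (t : ℝ≥0∞) < γ ω} from ⟨rfl, hω⟩) (by simp [h])
    · exact (Set.inter_eq_right.1 h hω').symm
  · rintro ⟨hf, hc⟩
    refine Measurable.stronglyMeasurable fun B hB => ⟨hf hB, ?_⟩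
    rcases Set.eq_empty_or_nonempty (f ⁻¹' B ∩ {ω | (t : ℝ≥0∞) < γ ω}) with h | ⟨ω₀, h₀, ht₀⟩
    · exact Or.inl h
    · refine Or.inr (Set.inter_eq_right.2 fun ω hω => ?_)
      rw [Set.mem_preimage, hc ω ω₀ hω ht₀]
      exact h₀

/-- If a stopping time occurs strictly before `γ` somewhere, it has occurred by then at every point
where `γ` is larger. -/
theorem IsStoppingTime.le_of_lt_of_lt {τ : Ω → ℝ≥0∞}
    (hτ : IsStoppingTime (singleJumpFiltration (mΩ := mΩ) γ) τ) {ω ω' : Ω}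
    (h : τ ω < γ ω) (h' : τ ω < γ ω') : τ ω' ≤ τ ω := by
  have hr : ((τ ω).toNNReal : ℝ≥0∞) = τ ω := ENNReal.coe_toNNReal (ne_top_of_lt h)
  -- With `r = τ ω`, the event `{τ ≤ r}` meets `{r < γ}` at `ω`, so it contains all of `{r < γ}`.
  rcases (hτ (τ ω).toNNReal).2 with h0 | h0
  · have hmem : ω ∈ {ω₁ | τ ω₁ ≤ ((τ ω).toNNReal : ℝ≥0∞)} ∩
        {ω₁ | ((τ ω).toNNReal : ℝ≥0∞) < γ ω₁} :=
      ⟨hr.ge, by rw [Set.mem_ofPred_eq, hr]; exact h⟩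
    exact absurd (h0.subset hmem) (Set.notMem_empty _)
  · have hmem : ω' ∈ {ω₁ | ((τ ω).toNNReal : ℝ≥0∞) < γ ω₁} := by
      rw [Set.mem_ofPred_eq, hr]; exact h'
    exact (show τ ω' ≤ ((τ ω).toNNReal : ℝ≥0∞) from (h0.superset hmem).1).trans hr.le

theorem IsStoppingTime.eq_of_lt {τ : Ω → ℝ≥0∞}
    (hτ : IsStoppingTime (singleJumpFiltration (mΩ := mΩ) γ) τ) {ω ω' : Ω}
    (h : τ ω < γ ω) (h' : τ ω < γ ω') : τ ω' = τ ω := by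
  have h1 := IsStoppingTime.le_of_lt_of_lt hτ h h'
  exact le_antisymm h1 (IsStoppingTime.le_of_lt_of_lt hτ (h1.trans_lt h') (h1.trans_lt h))

/-- The event that `γ` occurs no later than a given stopping time is determined by `γ`. -/
theorem IsStoppingTime.exists_measurableSet_le_iff {τ : Ω → ℝ≥0∞}
    (hτ : IsStoppingTime (singleJumpFiltration (mΩ := mΩ) γ) τ) :
    ∃ S : Set ℝ≥0∞, MeasurableSet S ∧ ∀ ω, γ ω ≤ τ ω ↔ γ ω ∈ S := by
  by_cases h : ∃ ω, τ ω < γ ω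
  · obtain ⟨ω₀, h₀⟩ := h
    -- Wherever `τ` occurs strictly before `γ` it takes the same value `τ ω₀`, which is therefore
    -- the threshold for `γ`.
    refine ⟨Set.Iic (τ ω₀), measurableSet_Iic, fun ω => ?_⟩
    rw [Set.mem_Iic, ← not_lt, ← not_lt, not_iff_not]
    constructor
    · intro h
      rcases le_total (τ ω) (τ ω₀) with hle | hle
      · rwa [IsStoppingTime.eq_of_lt hτ h (hle.trans_lt h₀)]
      · exact hle.trans_lt h
    · intro h
      rwa [IsStoppingTime.eq_of_lt hτ h₀ h]
  · push Not at h
    exact ⟨Set.univ, MeasurableSet.univ, fun ω => by simp [h ω]⟩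

theorem smallestFiltration_le_singleJumpFiltration (hγ : Measurable γ) :
    smallestFiltration (mΩ := mΩ) γ ≤ singleJumpFiltration γ := by
  refine (isLeast_smallestFiltration hγ).2 ⟨isRightContinuous_singleJumpFiltration γ, fun t => ?_⟩
  have h : MeasurableSet {ω | γ ω ≤ (t : ℝ≥0∞)} := measurableSet_le hγ measurable_const
  exact ⟨h, Or.inl
    (Set.eq_empty_of_forall_notMem fun ω hω => absurd (show (t : ℝ≥0∞) < γ ω from hω.2)
      (not_lt_of_ge hω.1))⟩

/-- The filtration constantly equal to `σ(γ)` is a competitor in the definition of the smallest one.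
-/
theorem smallestFiltration_le_comap (hγ : Measurable γ) (t : ℝ≥0) :
    smallestFiltration (mΩ := mΩ) γ t ≤ MeasurableSpace.comap γ inferInstance := by
  have h : smallestFiltration (mΩ := mΩ) γ ≤
      Filtration.const ℝ≥0 (MeasurableSpace.comap γ inferInstance) hγ.comap_le := by
    refine (isLeast_smallestFiltration hγ).2 ⟨⟨fun s => ?_⟩, fun s => ?_⟩
    · rw [Filtration.rightCont_eq]
      exact iInf₂_le (s + 1) (by simp)
    · exact ⟨Set.Iic (s : ℝ≥0∞), measurableSet_Iic, rfl⟩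
  exact h t

theorem measurable_smallestFiltration_min (hγ : Measurable γ) (t : ℝ≥0) :
    Measurable[smallestFiltration (mΩ := mΩ) γ t] fun ω => min (γ ω) t := by
  have hst := (isLeast_smallestFiltration hγ).1.2
  refine measurable_of_Iic fun x => ?_
  rcases le_or_gt (t : ℝ≥0∞) x with hx | hx
  · have : (fun ω => min (γ ω) (t : ℝ≥0∞)) ⁻¹' Set.Iic x = Set.univ :=
      Set.eq_univ_of_forall fun ω => (min_le_right _ _).trans hx
    rw [this]; exact MeasurableSet.univ
  · lift x to ℝ≥0 using ne_top_of_lt hx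
    have : (fun ω => min (γ ω) (t : ℝ≥0∞)) ⁻¹' Set.Iic (x : ℝ≥0∞) = {ω | γ ω ≤ x} := by
      ext ω; simp [not_le.2 (ENNReal.coe_lt_coe.1 hx)]
    rw [this]
    exact (smallestFiltration (mΩ := mΩ) γ).mono (ENNReal.coe_lt_coe.1 hx).le _ (hst x)

/-- On `{γ ≤ t}` one may replace `γ` by `min γ t`, which is known at time `t`. -/
theorem stronglyMeasurable_smallestFiltration_ite (hγ : Measurable γ) (t : ℝ≥0)
    {g : ℝ≥0∞ → ℝ} (hg : Measurable g) (c : ℝ) :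
    StronglyMeasurable[smallestFiltration (mΩ := mΩ) γ t]
      fun ω => if γ ω ≤ t then g (γ ω) else c := by
  have h1 : Measurable[smallestFiltration (mΩ := mΩ) γ t] fun ω => g (min (γ ω) t) :=
    hg.comp (measurable_smallestFiltration_min hγ t)
  have h2 : MeasurableSet[smallestFiltration (mΩ := mΩ) γ t] {ω | γ ω ≤ t} :=
    (isLeast_smallestFiltration hγ).1.2 t
  have h3 : (fun ω => if γ ω ≤ t then g (γ ω) else c) =
      fun ω => if γ ω ≤ t then g (min (γ ω) t) else c := by
    ext ω
    split_ifs with h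
    · rw [min_eq_left h]
    · rfl
  rw [h3]
  exact (Measurable.ite h2 h1 measurable_const).stronglyMeasurable

/-- The finite time `s` is the same for all processes `X`, so several stopped processes can be
compared at one point. -/
theorem exists_stoppedProcess_eq (τ : Ω → ℝ≥0∞) (t : ℝ≥0) (ω : Ω) :
    ∃ s : ℝ≥0, (s : ℝ≥0∞) = min (t : ℝ≥0∞) (τ ω) ∧
      ∀ X : ℝ≥0 → Ω → ℝ, stoppedProcess X τ t ω = X s ω := by
  rcases le_total (t : ℝ≥0∞) (τ ω) with h | h
  · exact ⟨t, (min_eq_left h).symm, fun X => stoppedProcess_eq_of_le h⟩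
  · have hr : ((τ ω).toNNReal : ℝ≥0∞) = τ ω :=
      ENNReal.coe_toNNReal (ne_top_of_le_ne_top ENNReal.coe_ne_top h)
    refine ⟨(τ ω).toNNReal, by rw [hr, min_eq_right h], fun X => ?_⟩
    rw [stoppedProcess_eq_of_ge h]
    congr 1
    rw [← hr]
    rfl

theorem stoppedProcess_zero (τ : Ω → ℝ≥0∞) (X : ℝ≥0 → Ω → ℝ) :
    stoppedProcess X τ 0 = X 0 := by
  ext ω
  obtain ⟨s, hs, h⟩ := exists_stoppedProcess_eq τ 0 ω
  have : s = 0 := by simpa using hs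
  rw [h, this]

end Filtration

/-! ### Uniform integrability under conditional expectation. -/

section UniformIntegrability

variable {Ω : Type*} {mΩ : MeasurableSpace Ω} {P : Measure Ω} [IsFiniteMeasure P]

/-- The conditional expectations, with respect to one `σ`-field, of a uniformly integrable family
are uniformly integrable. -/
theorem uniformIntegrable_condExp_of_uniformIntegrable {ι : Type*} {X : ι → Ω → ℝ}
    (hX : UniformIntegrable X 1 P) {𝓖 : MeasurableSpace Ω} (h𝓖 : 𝓖 ≤ mΩ) :
    UniformIntegrable (fun i => P[X i | 𝓖]) 1 P := by
  have hsm : ∀ i, StronglyMeasurable[𝓖] (P[X i | 𝓖]) := fun i => stronglyMeasurable_condExp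
  have hmeas : ∀ i, ∀ C : ℝ≥0, MeasurableSet[𝓖] {x | C ≤ ‖(P[X i|𝓖]) x‖₊} := fun i C =>
    measurableSet_le measurable_const (hsm i).measurable.nnnorm
  refine uniformIntegrable_of le_rfl ENNReal.one_ne_top
    (fun i => ((hsm i).mono h𝓖).aestronglyMeasurable) fun ε hε => ?_
  obtain ⟨δ, hδ, h⟩ := hX.2.1 hε
  obtain ⟨K, hK⟩ := hX.2.2
  -- Markov's inequality bounds the tail probability by `K / C ≤ δ`; the `+ 1` keeps `C` positive.
  set C : ℝ≥0 := (K + 1) / δ.toNNReal with hC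
  have hδ' : 0 < δ.toNNReal := Real.toNNReal_pos.2 hδ
  have hCpos : 0 < C := by positivity
  refine ⟨C, fun i => ?_⟩
  have hsmall : P {x | C ≤ ‖(P[X i|𝓖]) x‖₊} ≤ ENNReal.ofReal δ := by
    have h1 := mul_meas_ge_le_pow_eLpNorm P one_ne_zero ENNReal.one_ne_top
      ((hsm i).mono h𝓖).aestronglyMeasurable C
    simp only [ENNReal.toReal_one, ENNReal.rpow_one, enorm_eq_nnnorm, ENNReal.coe_le_coe] at h1
    have h2 : (C : ℝ≥0∞) * P {x | C ≤ ‖(P[X i|𝓖]) x‖₊} ≤ K :=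
      h1.trans ((eLpNorm_condExp_le_eLpNorm _ le_rfl).trans (hK i))
    have h3 : (K : ℝ≥0∞) ≤ C * ENNReal.ofReal δ := by
      rw [ENNReal.ofReal, ← ENNReal.coe_mul, hC, div_mul_cancel₀ _ hδ'.ne']
      exact ENNReal.coe_le_coe.2 (by simp)
    exact (ENNReal.mul_le_mul_iff_right (ENNReal.coe_ne_zero.2 hCpos.ne') ENNReal.coe_ne_top).1
      (h2.trans h3)
  have hint : Integrable (X i) P := memLp_one_iff_integrable.1 (hX.memLp i)
  -- The tail event lies in `𝓖`, so truncation commutes with conditioning and the `L¹` contraction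
  -- applies.
  rw [← eLpNorm_congr_ae (condExp_indicator hint (hmeas i C))]
  exact (eLpNorm_condExp_le_eLpNorm _ le_rfl).trans (h i _ (h𝓖 _ (hmeas i C)) hsmall)

end UniformIntegrability

/-! ### Local martingales are frozen after `γ`. -/

section LocalMartingale

variable {Ω : Type*} {mΩ : MeasurableSpace Ω} {P : Measure Ω} {γ : Ω → ℝ≥0∞}

theorem ae_exists_lt_of_isLocalizingSequence {𝓕 : Filtration ℝ≥0 mΩ} {τ : ℕ → Ω → ℝ≥0∞}
    (hτ : IsLocalizingSequence 𝓕 τ P) :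
    ∀ᵐ ω ∂P, ∀ t : ℝ≥0, ∀ᶠ n in atTop, (t : ℝ≥0∞) < τ n ω := by
  filter_upwards [hτ.tendsto_top] with ω hω t
  exact hω.eventually (lt_mem_nhds (ENNReal.coe_lt_top (r := t)))

variable [IsProbabilityMeasure P]

/-- A martingale for the single jump filtration does not move after `γ`. -/
theorem martingale_ae_eq_of_le (hγ : Measurable γ) {X : ℝ≥0 → Ω → ℝ}
    (hX : Martingale X (singleJumpFiltration γ) P) {s t : ℝ≥0} (hst : s ≤ t) :
    ∀ᵐ ω ∂P, γ ω ≤ s → X t ω = X s ω := by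
  have hle := (singleJumpFiltration (mΩ := mΩ) γ).le s
  have hS : MeasurableSet {ω | γ ω ≤ (s : ℝ≥0∞)} := measurableSet_le hγ measurable_const
  have hSs : MeasurableSet[singleJumpFiltration (mΩ := mΩ) γ s] {ω | γ ω ≤ (s : ℝ≥0∞)} :=
    ⟨hS, Or.inl (Set.eq_empty_of_forall_notMem fun ω hω =>
      absurd (show (s : ℝ≥0∞) < γ ω from hω.2) (not_lt_of_ge hω.1))⟩
  -- `X t` cut off to `{γ ≤ s}` vanishes on `{s < γ}`, so it is known at time `s` and is its own
  -- conditional expectation.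
  have hm : StronglyMeasurable[singleJumpFiltration (mΩ := mΩ) γ s]
      ({ω | γ ω ≤ (s : ℝ≥0∞)}.indicator (X t)) := by
    refine stronglyMeasurable_singleJumpFiltration_iff.2
      ⟨(((hX.1 t).mono ((singleJumpFiltration γ).le t)).measurable).indicator hS,
        fun ω ω' hω hω' => ?_⟩
    rw [Set.indicator_of_notMem (by simpa using hω), Set.indicator_of_notMem (by simpa using hω')]
  have h1 := condExp_indicator (hX.integrable t) hSs
  rw [condExp_of_stronglyMeasurable hle hm ((hX.integrable t).indicator hS)] at h1
  filter_upwards [h1, hX.2 s t hst] with ω h1 h2 hω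
  rw [Set.indicator_of_mem (show ω ∈ {ω | γ ω ≤ (s : ℝ≥0∞)} from hω),
    Set.indicator_of_mem (show ω ∈ {ω | γ ω ≤ (s : ℝ≥0∞)} from hω), h2] at h1
  exact h1

/-- The value of a process at a measurable integer-valued time after `γ`. -/
noncomputable def valueAfter (γ : Ω → ℝ≥0∞) (X : ℝ≥0 → Ω → ℝ) (ω : Ω) : ℝ :=
  -- Where `γ = ∞` this is `X 0 ω`, a default value: the frozen value matters only where `γ ≤ t` for
  -- some finite `t`.
  X (⌈(γ ω).toNNReal⌉₊ : ℕ) ω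

/-- The time is integer-valued, so joint measurability of `X` is not needed. -/
theorem measurable_valueAfter {𝓖 : MeasurableSpace Ω} (hγ : Measurable[𝓖] γ) {X : ℝ≥0 → Ω → ℝ}
    (hX : ∀ t, Measurable[𝓖] (X t)) : Measurable[𝓖] (valueAfter γ X) := by
  have h1 : Measurable[𝓖] fun ω => (⌈(γ ω).toNNReal⌉₊ : ℕ) :=
    Nat.measurable_ceil.comp (ENNReal.measurable_toNNReal.comp hγ)
  have h2 : Measurable fun p : ℕ × Ω => X (p.1 : ℝ≥0) p.2 :=
    measurable_from_prod_countable_right fun n => hX n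
  exact h2.comp (h1.prodMk measurable_id)

/-- A local martingale for the single jump filtration does not move after `γ`. -/
theorem IsLocalMartingale.ae_eq_valueAfter (hγ : Measurable γ) {X : ℝ≥0 → Ω → ℝ}
    (hX : IsLocalMartingale X (singleJumpFiltration γ) P) :
    ∀ᵐ ω ∂P, ∀ t : ℝ≥0, γ ω ≤ t → X t ω = valueAfter γ X ω := by
  obtain ⟨-, hcad, τ, hτ, hmart⟩ := hX
  -- One null set must serve all times: rational times come first, then right-continuity gives the
  -- rest.
  have h1 : ∀ᵐ ω ∂P, ∀ n : ℕ, ∀ s : {s : ℝ≥0 // ∃ q : ℚ≥0, (q : ℝ≥0) = s},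
      ∀ t : {s : ℝ≥0 // ∃ q : ℚ≥0, (q : ℝ≥0) = s}, s.1 ≤ t.1 → γ ω ≤ s.1 →
        stoppedProcess X (τ n) t.1 ω = stoppedProcess X (τ n) s.1 ω := by
    have : Countable {s : ℝ≥0 // ∃ q : ℚ≥0, (q : ℝ≥0) = s} :=
      (Set.countable_range fun q : ℚ≥0 => (q : ℝ≥0)).to_subtype
    rw [ae_all_iff]; intro n
    rw [ae_all_iff]; intro s
    rw [ae_all_iff]; intro t
    by_cases hst : s.1 ≤ t.1
    · filter_upwards [martingale_ae_eq_of_le hγ (hmart n).1 hst] with ω h _ using h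
    · exact Eventually.of_forall fun ω h => absurd h hst
  filter_upwards [h1, hcad, ae_exists_lt_of_isLocalizingSequence hτ] with ω h1 hcad hlim
  have hrat : ∀ p q : ℚ≥0, p ≤ q → γ ω ≤ (p : ℝ≥0) → X q ω = X p ω := by
    intro p q hpq hp
    obtain ⟨n, hn⟩ := (hlim q).exists
    have hpq' : (p : ℝ≥0) ≤ q := by exact_mod_cast hpq
    have h := h1 n ⟨p, p, rfl⟩ ⟨q, q, rfl⟩ hpq' hp
    rwa [stoppedProcess_eq_of_le hn.le,
      stoppedProcess_eq_of_le ((ENNReal.coe_le_coe.2 hpq').trans hn.le)] at h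
  intro t ht
  have hγt : γ ω ≠ ⊤ := ne_top_of_le_ne_top ENNReal.coe_ne_top ht
  set k : ℕ := ⌈(γ ω).toNNReal⌉₊ with hk
  have hγk : γ ω ≤ ((k : ℚ≥0) : ℝ≥0) := by
    rw [← ENNReal.coe_toNNReal hγt]
    exact ENNReal.coe_le_coe.2 (by simpa using Nat.le_ceil _)
  have hall : ∀ q : ℚ≥0, γ ω ≤ (q : ℝ≥0) → X q ω = X ((k : ℚ≥0) : ℝ≥0) ω := by
    intro q hq
    rcases le_total q (k : ℚ≥0) with h | h
    · exact (hrat _ _ h hq).symm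
    · exact hrat _ _ h hγk
  have hval : valueAfter γ X ω = X ((k : ℚ≥0) : ℝ≥0) ω := by simp [valueAfter, hk]
  rw [hval]
  have hclos : t ∈ closure (Set.range (fun q : ℚ≥0 => (q : ℝ≥0)) ∩ Set.Ici t) := by
    refine Metric.mem_closure_iff.2 fun ε hε => ?_
    have hlt : t < t + ε.toNNReal := lt_add_of_pos_right t (Real.toNNReal_pos.2 hε)
    obtain ⟨q, hq0, hq1, hq2⟩ := (NNReal.lt_iff_exists_rat_btwn _ _).1 hlt
    lift q to ℚ≥0 using hq0
    have hqq : Real.toNNReal ((q : ℚ) : ℝ) = (q : ℝ≥0) := by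
      have : ((q : ℚ) : ℝ) = ((q : ℝ≥0) : ℝ) := by simp; rfl
      rw [this, Real.toNNReal_coe]
    rw [hqq] at hq1 hq2
    refine ⟨(q : ℝ≥0), ⟨⟨q, rfl⟩, hq1.le⟩, ?_⟩
    rw [NNReal.dist_eq, abs_sub_comm, abs_of_nonneg (sub_nonneg.2 (NNReal.coe_le_coe.2 hq1.le)),
      sub_lt_iff_lt_add']
    have := NNReal.coe_lt_coe.2 hq2
    rwa [NNReal.coe_add, Real.coe_toNNReal ε hε.le] at this
  have hne : (𝓝[Set.range (fun q : ℚ≥0 => (q : ℝ≥0)) ∩ Set.Ici t] t).NeBot :=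
    mem_closure_iff_nhdsWithin_neBot.1 hclos
  have ht1 : Tendsto (fun s => X s ω) (𝓝[Set.range (fun q : ℚ≥0 => (q : ℝ≥0)) ∩ Set.Ici t] t)
      (𝓝 (X t ω)) := (hcad.1 t).mono_left (nhdsWithin_mono _ Set.inter_subset_right)
  refine tendsto_nhds_unique ht1 (tendsto_const_nhds.congr' ?_)
  filter_upwards [self_mem_nhdsWithin] with s hs
  obtain ⟨⟨q, rfl⟩, hq⟩ := hs
  exact (hall q (ht.trans (ENNReal.coe_le_coe.2 hq))).symm

end LocalMartingale

section Sub

theorem IsCadlag.sub {f g : ℝ≥0 → ℝ} (hf : IsCadlag f) (hg : IsCadlag g) :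
    IsCadlag (f - g) := by
  refine ⟨fun t => (hf.1 t).sub (hg.1 t), fun t ht => ?_⟩
  obtain ⟨a, ha⟩ := hf.2 t ht
  obtain ⟨b, hb⟩ := hg.2 t ht
  exact ⟨a - b, ha.sub hb⟩

theorem uniformIntegrable_sub {Ω ι : Type*} {mΩ : MeasurableSpace Ω} {P : Measure Ω} {X Y : ι → Ω → ℝ} (hX : UniformIntegrable X 1 P)
    (hY : UniformIntegrable Y 1 P) : UniformIntegrable (X - Y) 1 P := by
  obtain ⟨hX1, hX2, A, hA⟩ := hX
  obtain ⟨hY1, hY2, B, hB⟩ := hY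
  refine ⟨fun i => (hX1 i).sub (hY1 i), hX2.sub hY2 le_rfl hX1 hY1, A + B, fun i => ?_⟩
  exact (eLpNorm_sub_le (hX1 i) (hY1 i) le_rfl).trans (by push_cast; exact add_le_add (hA i) (hB i))

end Sub

/-! ### Existence: projection of the terminal value onto `σ(γ)`. -/

section Projection

variable {Ω : Type*} {mΩ : MeasurableSpace Ω} {P : Measure Ω} [IsProbabilityMeasure P]
  {γ : Ω → ℝ≥0∞}

/-- A version of the conditional mean of `L` given `γ = x`, defined without integrability
assumptions on `L`. -/
noncomputable def conditionalMean (P : Measure Ω) [IsProbabilityMeasure P] (γ : Ω → ℝ≥0∞)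
    (L : Ω → ℝ) (x : ℝ≥0∞) : ℝ :=
  ∫ y, y ∂condDistrib L γ P x

theorem measurable_conditionalMean (L : Ω → ℝ) : Measurable (conditionalMean P γ L) := by
  have h : StronglyMeasurable fun p : ℝ≥0∞ × ℝ => p.2 := measurable_snd.stronglyMeasurable
  exact (StronglyMeasurable.integral_condDistrib (X := γ) (Y := L) (μ := P) h).measurable

/-- The conditional mean is the conditional expectation on every event determined by `γ` on which
`L` is integrable. -/
theorem condExp_indicator_preimage (hγ : Measurable γ) {L : Ω → ℝ} (hL : Measurable L)
    {S : Set ℝ≥0∞} (hS : MeasurableSet S) (hint : Integrable ((γ ⁻¹' S).indicator L) P) :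
    P[(γ ⁻¹' S).indicator L | MeasurableSpace.comap γ inferInstance] =ᵐ[P]
      (γ ⁻¹' S).indicator fun ω => conditionalMean P γ L (γ ω) := by
  -- The integrand `(x, y) ↦ 1_S(x) y` carries the cutoff, so `L` itself need not be integrable.
  have hf : StronglyMeasurable fun p : ℝ≥0∞ × ℝ => (Prod.fst ⁻¹' S).indicator Prod.snd p :=
    (measurable_snd.indicator (measurable_fst hS)).stronglyMeasurable
  have h := condExp_prod_ae_eq_integral_condDistrib (X := γ) (Y := L) (μ := P) hγ hL.aemeasurable hf
    (by exact hint)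
  refine (EventuallyEq.of_eq ?_).trans (h.trans (EventuallyEq.of_eq ?_))
  · rfl
  · ext ω
    by_cases hω : γ ω ∈ S
    · simp [Set.indicator, hω, conditionalMean]
    · simp [Set.indicator, hω]

/-- The process which follows `X` before `γ` and then jumps to the conditional mean given `γ` of the
value of `X` after `γ`. -/
noncomputable def meanPart (P : Measure Ω) [IsProbabilityMeasure P] (γ : Ω → ℝ≥0∞)
    (X : ℝ≥0 → Ω → ℝ) (t : ℝ≥0) (ω : Ω) : ℝ :=
  if γ ω ≤ t then conditionalMean P γ (valueAfter γ X) (γ ω) else X t ω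

theorem stoppedProcess_meanPart (X : ℝ≥0 → Ω → ℝ) (τ : Ω → ℝ≥0∞) (t : ℝ≥0) (ω : Ω) :
    stoppedProcess (meanPart P γ X) τ t ω =
      if γ ω ≤ min (t : ℝ≥0∞) (τ ω) then conditionalMean P γ (valueAfter γ X) (γ ω)
      else stoppedProcess X τ t ω := by
  obtain ⟨s, hs, h⟩ := exists_stoppedProcess_eq τ t ω
  rw [h, h, ← hs, meanPart]

theorem stronglyAdapted_meanPart (hγ : Measurable γ) {X : ℝ≥0 → Ω → ℝ}
    (hX : StronglyAdapted (singleJumpFiltration (mΩ := mΩ) γ) X) :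
    StronglyAdapted (smallestFiltration (mΩ := mΩ) γ) (meanPart P γ X) := by
  intro t
  have hc := (stronglyMeasurable_singleJumpFiltration_iff.1 (hX t)).2
  have hg := measurable_conditionalMean (P := P) (γ := γ) (valueAfter γ X)
  by_cases h : ∃ ω, (t : ℝ≥0∞) < γ ω
  · obtain ⟨ω₀, h₀⟩ := h
    convert stronglyMeasurable_smallestFiltration_ite hγ t hg (X t ω₀) using 2 with ω
    rw [meanPart]
    split_ifs with hω
    · rfl
    · exact hc _ _ (not_le.1 hω) h₀
  · push Not at h
    convert stronglyMeasurable_smallestFiltration_ite hγ t hg 0 using 2 with ω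
    rw [meanPart, if_pos (h ω), if_pos (h ω)]

/-- Before `γ`, an adapted process stopped at a stopping time is deterministic. -/
theorem stoppedProcess_eq_of_lt {X : ℝ≥0 → Ω → ℝ}
    (hX : StronglyAdapted (singleJumpFiltration (mΩ := mΩ) γ) X) {τ : Ω → ℝ≥0∞}
    (hτ : IsStoppingTime (singleJumpFiltration (mΩ := mΩ) γ) τ) {t : ℝ≥0} {ω ω' : Ω}
    (h : min (t : ℝ≥0∞) (τ ω) < γ ω) (h' : min (t : ℝ≥0∞) (τ ω') < γ ω') :
    stoppedProcess X τ t ω = stoppedProcess X τ t ω' := by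
  wlog hle : min (t : ℝ≥0∞) (τ ω) ≤ min (t : ℝ≥0∞) (τ ω') generalizing ω ω'
  · exact (this h' h (le_of_not_ge hle)).symm
  have heq : min (t : ℝ≥0∞) (τ ω) = min (t : ℝ≥0∞) (τ ω') := by
    rcases le_total (t : ℝ≥0∞) (τ ω) with h1 | h1
    · refine le_antisymm hle ?_
      rw [min_eq_left h1]; exact min_le_left _ _
    · rw [min_eq_right h1] at h hle
      rw [IsStoppingTime.eq_of_lt hτ h (hle.trans_lt h')]
  obtain ⟨s, hs, hXs⟩ := exists_stoppedProcess_eq τ t ω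
  obtain ⟨s', hs', hXs'⟩ := exists_stoppedProcess_eq τ t ω'
  have hss : s = s' := by
    rw [← heq, ← hs] at hs'
    exact (ENNReal.coe_inj.1 hs').symm
  subst hss
  rw [hXs, hXs']
  exact (stronglyMeasurable_singleJumpFiltration_iff.1 (hX s)).2 _ _ (hs ▸ h) (hs' ▸ h')

/-- The mean part of a local martingale, stopped at a reducing time, is its projection on the
`σ`-field generated by `γ`. -/
theorem stoppedProcess_meanPart_ae_eq_condExp (hγ : Measurable γ) {X : ℝ≥0 → Ω → ℝ}
    (hX : StronglyAdapted (singleJumpFiltration (mΩ := mΩ) γ) X)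
    (hafter : ∀ᵐ ω ∂P, ∀ t : ℝ≥0, γ ω ≤ t → X t ω = valueAfter γ X ω) {τ : Ω → ℝ≥0∞}
    (hτ : IsStoppingTime (singleJumpFiltration (mΩ := mΩ) γ) τ) {t : ℝ≥0}
    (hint : Integrable (stoppedProcess X τ t) P) :
    stoppedProcess (meanPart P γ X) τ t =ᵐ[P]
      P[stoppedProcess X τ t | MeasurableSpace.comap γ inferInstance] := by
  obtain ⟨S, hS, hSτ⟩ := IsStoppingTime.exists_measurableSet_le_iff hτ
  set T : Set ℝ≥0∞ := S ∩ Set.Iic (t : ℝ≥0∞) with hT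
  have hTm : MeasurableSet T := hS.inter measurableSet_Iic
  have hTiff : ∀ ω, γ ω ≤ min (t : ℝ≥0∞) (τ ω) ↔ ω ∈ γ ⁻¹' T := fun ω => by
    rw [le_min_iff, hSτ ω]; exact and_comm
  have hL : Measurable (valueAfter γ X) :=
    measurable_valueAfter hγ fun s => ((hX s).mono ((singleJumpFiltration γ).le s)).measurable
  have h1 : (γ ⁻¹' T).indicator (valueAfter γ X) =ᵐ[P]
      (γ ⁻¹' T).indicator (stoppedProcess X τ t) := by
    filter_upwards [hafter] with ω hω
    by_cases hωT : ω ∈ γ ⁻¹' T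
    · obtain ⟨s, hs, hXs⟩ := exists_stoppedProcess_eq τ t ω
      rw [Set.indicator_of_mem hωT, Set.indicator_of_mem hωT, hXs,
        hω s (hs ▸ (hTiff ω).2 hωT)]
    · rw [Set.indicator_of_notMem hωT, Set.indicator_of_notMem hωT]
  have hint1 : Integrable ((γ ⁻¹' T).indicator (valueAfter γ X)) P :=
    (hint.indicator (hγ hTm)).congr h1.symm
  -- Off `{γ ∈ T}` the stopped process has not reached `γ`, so it is a single constant there, and
  -- conditioning leaves that part unchanged.
  have h2 : ∃ c : ℝ, (γ ⁻¹' T)ᶜ.indicator (stoppedProcess X τ t) =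
      (γ ⁻¹' T)ᶜ.indicator fun _ => c := by
    by_cases h : ∃ ω, ω ∉ γ ⁻¹' T
    · obtain ⟨ω₀, h₀⟩ := h
      refine ⟨stoppedProcess X τ t ω₀, Set.indicator_congr fun ω hω => ?_⟩
      exact stoppedProcess_eq_of_lt hX hτ (not_le.1 (mt (hTiff ω).1 hω))
        (not_le.1 (mt (hTiff ω₀).1 h₀))
    · push Not at h
      exact ⟨0, Set.indicator_congr fun ω hω => absurd (h ω) hω⟩
  obtain ⟨c, hc⟩ := h2
  have hcm : StronglyMeasurable[MeasurableSpace.comap γ inferInstance]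
      ((γ ⁻¹' T)ᶜ.indicator fun _ => c) :=
    stronglyMeasurable_const.indicator (MeasurableSet.compl ⟨T, hTm, rfl⟩)
  have hci : Integrable ((γ ⁻¹' T)ᶜ.indicator fun _ => c) P :=
    (integrable_const c).indicator (hγ hTm).compl
  have hsum : stoppedProcess X τ t =ᵐ[P]
      (γ ⁻¹' T).indicator (valueAfter γ X) + (γ ⁻¹' T)ᶜ.indicator fun _ => c := by
    filter_upwards [h1] with ω h1
    rw [← hc, Pi.add_apply, h1, ← Pi.add_apply, Set.indicator_self_add_compl]
  have h3 := condExp_add hint1 hci (MeasurableSpace.comap γ inferInstance)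
  rw [condExp_of_stronglyMeasurable hγ.comap_le hcm hci] at h3
  filter_upwards [condExp_congr_ae (m := MeasurableSpace.comap γ inferInstance) hsum, h3,
    condExp_indicator_preimage hγ hL hTm hint1] with ω e1 e2 e3
  rw [e1, e2, Pi.add_apply, e3, stoppedProcess_meanPart]
  by_cases hω : ω ∈ γ ⁻¹' T
  · rw [if_pos ((hTiff ω).2 hω), Set.indicator_of_mem hω, Set.indicator_of_notMem (by simpa using hω),
      add_zero]
  · rw [if_neg (mt (hTiff ω).1 hω), Set.indicator_of_notMem hω, zero_add, ← hc,
      Set.indicator_of_mem (show ω ∈ (γ ⁻¹' T)ᶜ from hω)]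

/-- Nothing moves on `{γ ≤ s}`, and `{s < γ}` belongs both to `σ(γ)` and to the `σ`-field at time
`s`, so projecting onto `σ(γ)` preserves the martingale identity there. -/
theorem martingale_stoppedProcess_meanPart (hγ : Measurable γ) {X : ℝ≥0 → Ω → ℝ}
    (hX : StronglyAdapted (singleJumpFiltration (mΩ := mΩ) γ) X)
    (hafter : ∀ᵐ ω ∂P, ∀ t : ℝ≥0, γ ω ≤ t → X t ω = valueAfter γ X ω) {τ : Ω → ℝ≥0∞}
    (hτ : IsStoppingTime (singleJumpFiltration (mΩ := mΩ) γ) τ)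
    (hm : Martingale (stoppedProcess X τ) (singleJumpFiltration γ) P) :
    Martingale (stoppedProcess (meanPart P γ X) τ) (singleJumpFiltration γ) P := by
  have hproj := fun t => stoppedProcess_meanPart_ae_eq_condExp hγ hX hafter hτ (hm.integrable t)
  have hint : ∀ t, Integrable (stoppedProcess (meanPart P γ X) τ t) P := fun t =>
    integrable_condExp.congr (hproj t).symm
  have hmeas : Measurable fun ω => conditionalMean P γ (valueAfter γ X) (γ ω) :=
    (measurable_conditionalMean _).comp hγ
  obtain ⟨S, hS, hSτ⟩ := IsStoppingTime.exists_measurableSet_le_iff hτ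
  have hadapt : StronglyAdapted (singleJumpFiltration (mΩ := mΩ) γ) (stoppedProcess (meanPart P γ X) τ) := by
    intro t
    obtain ⟨hm1, hm2⟩ := stronglyMeasurable_singleJumpFiltration_iff.1 (hm.1 t)
    refine stronglyMeasurable_singleJumpFiltration_iff.2 ⟨?_, fun ω ω' hω hω' => ?_⟩
    · have hset : MeasurableSet {ω | γ ω ≤ min (t : ℝ≥0∞) (τ ω)} := by
        have : {ω | γ ω ≤ min (t : ℝ≥0∞) (τ ω)} = γ ⁻¹' (Set.Iic (t : ℝ≥0∞) ∩ S) := by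
          ext ω
          rw [Set.mem_ofPred_eq, le_min_iff, hSτ ω]; rfl
        rw [this]
        exact hγ (measurableSet_Iic.inter hS)
      convert Measurable.ite hset hmeas hm1 using 2 with ω
      exact stoppedProcess_meanPart X τ t ω
    · rw [stoppedProcess_meanPart, stoppedProcess_meanPart,
        if_neg (not_le.2 ((min_le_left _ _).trans_lt hω)),
        if_neg (not_le.2 ((min_le_left _ _).trans_lt hω')), hm2 ω ω' hω hω']
  refine ⟨hadapt, fun s t hst => ?_⟩
  have hle := (singleJumpFiltration (mΩ := mΩ) γ).le s
  refine (ae_eq_condExp_of_forall_setIntegral_eq hle (hint t) (fun A _ _ => (hint s).integrableOn)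
    (fun A hA _ => ?_) (hadapt s).aestronglyMeasurable).symm
  have hzero : ∀ ω, γ ω ≤ s → stoppedProcess (meanPart P γ X) τ s ω =
      stoppedProcess (meanPart P γ X) τ t ω := by
    intro ω hω
    have hst' : (s : ℝ≥0∞) ≤ t := ENNReal.coe_le_coe.2 hst
    rcases le_or_gt (γ ω) (τ ω) with h | h
    · rw [stoppedProcess_meanPart, stoppedProcess_meanPart, if_pos (le_min hω h),
        if_pos (le_min (hω.trans hst') h)]
    · rw [stoppedProcess_eq_of_ge (h.le.trans hω),
        stoppedProcess_eq_of_ge ((h.le.trans hω).trans hst')]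
  have hGm : MeasurableSet {ω | (s : ℝ≥0∞) < γ ω} := measurableSet_lt measurable_const hγ
  have hGγ : MeasurableSet[MeasurableSpace.comap γ inferInstance] {ω | (s : ℝ≥0∞) < γ ω} :=
    ⟨Set.Ioi (s : ℝ≥0∞), measurableSet_Ioi, rfl⟩
  have hGs : MeasurableSet[singleJumpFiltration (mΩ := mΩ) γ s] {ω | (s : ℝ≥0∞) < γ ω} :=
    ⟨hGm, Or.inr (Set.inter_self _)⟩
  have hkey : ∫ ω in {ω | (s : ℝ≥0∞) < γ ω}, stoppedProcess (meanPart P γ X) τ s ω ∂P =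
      ∫ ω in {ω | (s : ℝ≥0∞) < γ ω}, stoppedProcess (meanPart P γ X) τ t ω ∂P := by
    rw [setIntegral_congr_ae hGm ((hproj s).mono fun ω h _ => h),
      setIntegral_congr_ae hGm ((hproj t).mono fun ω h _ => h),
      setIntegral_condExp hγ.comap_le (hm.integrable s) hGγ,
      setIntegral_condExp hγ.comap_le (hm.integrable t) hGγ]
    exact hm.setIntegral_eq hst hGs
  -- The increment lives on `A ∩ {s < γ}`, which is either empty or all of `{s < γ}`.
  rw [← sub_eq_zero, ← integral_sub (hint s).integrableOn (hint t).integrableOn,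
    setIntegral_eq_of_subset_of_forall_sdiff_eq_zero (s := A ∩ {ω | (s : ℝ≥0∞) < γ ω}) hA.1
      Set.inter_subset_left]
  · rcases hA.2 with h | h
    · rw [h]; simp
    · rw [h, integral_sub (hint s).integrableOn (hint t).integrableOn, hkey, sub_self]
  · intro ω hω
    have : γ ω ≤ s := not_lt.1 fun h => hω.2 ⟨hω.1, h⟩
    rw [hzero ω this, sub_self]

theorem isCadlag_meanPart {X : ℝ≥0 → Ω → ℝ} {ω : Ω} (h : IsCadlag fun t => X t ω) :
    IsCadlag fun t => meanPart P γ X t ω := by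
  refine ⟨fun t => ?_, fun t ht => ?_⟩
  · rcases le_or_gt (γ ω) t with hγt | hγt
    · refine (continuousWithinAt_const (b := conditionalMean P γ (valueAfter γ X) (γ ω))).congr
        (fun s hs => ?_) ?_
      · rw [meanPart, if_pos (hγt.trans (ENNReal.coe_le_coe.2 hs))]
      · rw [meanPart, if_pos hγt]
    · refine (h.1 t).congr_of_eventuallyEq ?_ ?_
      · have hev : ∀ᶠ s : ℝ≥0 in 𝓝 t, (s : ℝ≥0∞) < γ ω :=
          ENNReal.continuous_coe.continuousAt.eventually (gt_mem_nhds hγt)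
        filter_upwards [nhdsWithin_le_nhds hev] with s hs
        rw [meanPart, if_neg (not_le.2 hs)]
      · rw [meanPart, if_neg (not_le.2 hγt)]
  -- At `t = γ ω` the left-hand limit still sees only `X`.
  · rcases lt_or_ge (γ ω) t with hγt | hγt
    · refine ⟨conditionalMean P γ (valueAfter γ X) (γ ω), tendsto_const_nhds.congr' ?_⟩
      have hev : ∀ᶠ s : ℝ≥0 in 𝓝 t, γ ω < (s : ℝ≥0∞) :=
        ENNReal.continuous_coe.continuousAt.eventually (lt_mem_nhds hγt)
      filter_upwards [nhdsWithin_le_nhds hev] with s hs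
      rw [meanPart, if_pos hs.le]
    · obtain ⟨l, hl⟩ := h.2 t ht
      refine ⟨l, hl.congr' ?_⟩
      filter_upwards [self_mem_nhdsWithin] with s hs
      rw [meanPart, if_neg (not_le.2 ((ENNReal.coe_lt_coe.2 hs).trans_le hγt))]

theorem uniformIntegrable_stoppedProcess_meanPart (hγ : Measurable γ) {X : ℝ≥0 → Ω → ℝ}
    (hX : StronglyAdapted (singleJumpFiltration (mΩ := mΩ) γ) X)
    (hafter : ∀ᵐ ω ∂P, ∀ t : ℝ≥0, γ ω ≤ t → X t ω = valueAfter γ X ω) {τ : Ω → ℝ≥0∞}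
    (hτ : IsStoppingTime (singleJumpFiltration (mΩ := mΩ) γ) τ)
    (hu : UniformIntegrable (stoppedProcess X τ) 1 P) :
    UniformIntegrable (stoppedProcess (meanPart P γ X) τ) 1 P :=
  (uniformIntegrable_condExp_of_uniformIntegrable hu hγ.comap_le).ae_eq fun t =>
    (stoppedProcess_meanPart_ae_eq_condExp hγ hX hafter hτ
      (memLp_one_iff_integrable.1 (hu.memLp t))).symm

theorem isDecomposition_meanPart (hγ : Measurable γ) {X : ℝ≥0 → Ω → ℝ}
    (hX : IsLocalMartingale X (singleJumpFiltration γ) P) :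
    IsDecomposition P γ X (meanPart P γ X) (X - meanPart P γ X) := by
  have hafter := hX.ae_eq_valueAfter hγ
  obtain ⟨hadapt, hcad, τ, hτ, hmart⟩ := hX
  have hst : ∀ n, IsStoppingTime (singleJumpFiltration (mΩ := mΩ) γ) (τ n) := hτ.isStoppingTime
  have hadapt' := stronglyAdapted_meanPart (P := P) hγ hadapt
  have hadaptF : StronglyAdapted (singleJumpFiltration (mΩ := mΩ) γ) (meanPart P γ X) := fun t =>
    (hadapt' t).mono (smallestFiltration_le_singleJumpFiltration hγ t)
  have hcad' : ∀ᵐ ω ∂P, IsCadlag fun t => meanPart P γ X t ω :=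
    hcad.mono fun ω h => isCadlag_meanPart h
  have hmart' := fun n => martingale_stoppedProcess_meanPart hγ hadapt hafter (hst n) (hmart n).1
  have hui' := fun n =>
    uniformIntegrable_stoppedProcess_meanPart hγ hadapt hafter (hst n) (hmart n).2
  have hX0 : Integrable (X 0) P := by
    have := (hmart 0).1.integrable 0
    rwa [stoppedProcess_zero (τ 0)] at this
  have hproj : meanPart P γ X 0 =ᵐ[P] P[X 0 | MeasurableSpace.comap γ inferInstance] := by
    have := stoppedProcess_meanPart_ae_eq_condExp hγ hadapt hafter (hst 0)
      ((hmart 0).1.integrable 0)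
    rwa [stoppedProcess_zero (τ 0), stoppedProcess_zero (τ 0)] at this
  have hM0 : Integrable (meanPart P γ X 0) P := integrable_condExp.congr hproj.symm
  refine ⟨?_, ⟨hadaptF, hcad', τ, hτ, fun n => ⟨hmart' n, hui' n⟩⟩, ⟨fun t => (hadapt t).sub
    (hadaptF t), ?_, τ, hτ, fun n => ⟨(hmart n).1.sub (hmart' n), ?_⟩⟩, hadapt', ?_, hX0.sub hM0, ?_⟩
  · exact Eventually.of_forall fun ω t => by simp
  · filter_upwards [hcad, hcad'] with ω h h' using h.sub h'
  · exact uniformIntegrable_sub (hmart n).2 (hui' n)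
  · exact Eventually.of_forall fun ω t h => by simp [meanPart, not_le.2 h]
  · simp only [Pi.sub_apply]
    rw [integral_sub hX0 hM0, integral_congr_ae hproj, integral_condExp hγ.comap_le, sub_self]

end Projection

/-! ### Uniqueness: zero conditional mean of the second part. -/

section Uniqueness

variable {Ω : Type*} {mΩ : MeasurableSpace Ω} {P : Measure Ω} [IsProbabilityMeasure P]
  {γ : Ω → ℝ≥0∞}

/-- An integrable function with zero integral over all events `{γ ≤ x}` has zero conditional
expectation given `γ`. -/
theorem condExp_comap_eq_zero_of_forall_setIntegral_le_eq_zero (hγ : Measurable γ) {f : Ω → ℝ}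
    (hf : Integrable f P) (h : ∀ x, ∫ ω in γ ⁻¹' Set.Iic x, f ω ∂P = 0) :
    P[f | MeasurableSpace.comap γ inferInstance] =ᵐ[P] 0 := by
  have htot : ∫ ω, f ω ∂P = 0 := by simpa using h ⊤
  have hall : ∀ B : Set ℝ≥0∞, MeasurableSet B → ∫ ω in γ ⁻¹' B, f ω ∂P = 0 := by
    intro B hB
    induction B, hB using MeasurableSpace.induction_on_inter
      (BorelSpace.measurable_eq.trans (borel_eq_generateFrom_Iic ℝ≥0∞)) isPiSystem_Iic with
    | empty => simp
    | basic B hB =>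
      obtain ⟨x, rfl⟩ := hB
      exact h x
    | compl B hB ih =>
      have := integral_add_compl (hγ hB) hf
      rw [ih, zero_add, htot] at this
      rwa [Set.preimage_compl]
    | iUnion B hd hB ih =>
      rw [Set.preimage_iUnion, integral_iUnion (fun i => hγ (hB i))
        (fun i j hij => (hd hij).preimage γ) hf.integrableOn]
      simp [ih]
  refine (ae_eq_condExp_of_forall_setIntegral_eq hγ.comap_le hf (fun _ _ _ => integrableOn_zero)
    (fun A hA _ => ?_) stronglyMeasurable_zero.aestronglyMeasurable).symm
  obtain ⟨B, hB, rfl⟩ := hA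
  simp [hall B hB]

/-- For a local martingale that vanishes before `γ` and starts with zero mean, the value after `γ`
has zero conditional mean given `γ`, locally. -/
theorem condExp_indicator_valueAfter_eq_zero (hγ : Measurable γ) {Y : ℝ≥0 → Ω → ℝ}
    (hafter : ∀ᵐ ω ∂P, ∀ t : ℝ≥0, γ ω ≤ t → Y t ω = valueAfter γ Y ω)
    (hvanish : ∀ᵐ ω ∂P, ∀ t : ℝ≥0, (t : ℝ≥0∞) < γ ω → Y t ω = 0)
    (hzero : ∫ ω, Y 0 ω ∂P = 0) {τ : Ω → ℝ≥0∞}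
    (hm : Martingale (stoppedProcess Y τ) (singleJumpFiltration γ) P)
    {S : Set ℝ≥0∞} (hSτ : ∀ ω, γ ω ≤ τ ω ↔ γ ω ∈ S) (t : ℝ≥0) :
    Integrable ((γ ⁻¹' (S ∩ Set.Iic (t : ℝ≥0∞))).indicator (valueAfter γ Y)) P ∧
    P[(γ ⁻¹' (S ∩ Set.Iic (t : ℝ≥0∞))).indicator (valueAfter γ Y) |
      MeasurableSpace.comap γ inferInstance] =ᵐ[P] 0 := by
  have hrepr : ∀ s : ℝ≥0, (γ ⁻¹' (S ∩ Set.Iic (s : ℝ≥0∞))).indicator (valueAfter γ Y) =ᵐ[P]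
      stoppedProcess Y τ s := by
    intro s
    filter_upwards [hafter, hvanish] with ω h1 h2
    obtain ⟨r, hr, hYr⟩ := exists_stoppedProcess_eq τ s ω
    have hiff : ω ∈ γ ⁻¹' (S ∩ Set.Iic (s : ℝ≥0∞)) ↔ γ ω ≤ r := by
      rw [hr, le_min_iff, hSτ ω]; exact and_comm
    rw [hYr]
    by_cases hω : γ ω ≤ r
    · rw [Set.indicator_of_mem (hiff.2 hω), h1 r hω]
    · rw [Set.indicator_of_notMem (mt hiff.1 hω), h2 r (not_le.1 hω)]
  have hint : ∀ s : ℝ≥0, ∫ ω, (γ ⁻¹' (S ∩ Set.Iic (s : ℝ≥0∞))).indicator (valueAfter γ Y) ω ∂P =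
      0 := by
    intro s
    -- The stopped martingale keeps its initial mean, which is zero.
    have h := hm.setIntegral_eq (zero_le : (0 : ℝ≥0) ≤ s) MeasurableSet.univ
    rw [setIntegral_univ, setIntegral_univ, stoppedProcess_zero, hzero] at h
    rw [integral_congr_ae (hrepr s), ← h]
  have hi := (hm.integrable t).congr (hrepr t).symm
  refine ⟨hi, condExp_comap_eq_zero_of_forall_setIntegral_le_eq_zero hγ hi fun x => ?_⟩
  -- Restricting to `{γ ≤ x}` amounts to lowering the time from `t` to `min t x`, so the zero mean
  -- at that time suffices.
  obtain ⟨s, hs⟩ : ∃ s : ℝ≥0, (s : ℝ≥0∞) = min (t : ℝ≥0∞) x :=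
    ⟨(min (t : ℝ≥0∞) x).toNNReal, ENNReal.coe_toNNReal
      (ne_top_of_le_ne_top ENNReal.coe_ne_top (min_le_left _ _))⟩
  rw [← integral_indicator (hγ measurableSet_Iic), ← hint s, Set.indicator_indicator,
    ← Set.preimage_inter, hs, ← Set.Iic_inter_Iic, Set.inter_comm, Set.inter_assoc]

/-- The first component of a decomposition is the mean part. -/
theorem IsDecomposition.indistinguishable_meanPart (hγ : Measurable γ) {X Y Z : ℝ≥0 → Ω → ℝ}
    (hX : IsLocalMartingale X (singleJumpFiltration γ) P) (h : IsDecomposition P γ X Y Z) :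
    Indistinguishable P Y (meanPart P γ X) := by
  have hXafter := hX.ae_eq_valueAfter hγ
  have hYafter := h.localMartingale_fst.ae_eq_valueAfter hγ
  have hZafter := h.localMartingale_snd.ae_eq_valueAfter hγ
  obtain ⟨hXa, -, τ, hτ, hτm⟩ := hX
  obtain ⟨-, -, σ, hσ, hσm⟩ := h.localMartingale_snd
  have hτst : ∀ n, IsStoppingTime (singleJumpFiltration (mΩ := mΩ) γ) (τ n) := hτ.isStoppingTime
  have hσst : ∀ n, IsStoppingTime (singleJumpFiltration (mΩ := mΩ) γ) (σ n) := hσ.isStoppingTime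
  choose S hS hSτ using fun n => IsStoppingTime.exists_measurableSet_le_iff (hτst n)
  choose T hT hTσ using fun n => IsStoppingTime.exists_measurableSet_le_iff (hσst n)
  have hsum : ∀ᵐ ω ∂P, valueAfter γ X ω = valueAfter γ Y ω + valueAfter γ Z ω := by
    filter_upwards [h.sum_eq] with ω hω using hω _
  have hLX : Measurable (valueAfter γ X) :=
    measurable_valueAfter hγ fun s => ((hXa s).mono ((singleJumpFiltration γ).le s)).measurable
  have hLY : Measurable[MeasurableSpace.comap γ inferInstance] (valueAfter γ Y) :=
    measurable_valueAfter (comap_measurable γ) fun s =>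
      ((h.adapted_fst s).mono (smallestFiltration_le_comap hγ s)).measurable
  have hmean : ∀ᵐ ω ∂P, ∀ n m : ℕ, γ ω ∈ S n → γ ω ∈ T n → γ ω ≤ (m : ℝ≥0) →
      valueAfter γ Y ω = conditionalMean P γ (valueAfter γ X) (γ ω) := by
    rw [ae_all_iff]; intro n
    rw [ae_all_iff]; intro m
    set B : Set ℝ≥0∞ := T n ∩ Set.Iic ((m : ℝ≥0) : ℝ≥0∞) with hB
    -- On `{γ ∈ C}` the terminal values of both `X` and `Z` are integrable; that of `Y` follows by
    -- subtraction.
    set C : Set ℝ≥0∞ := S n ∩ B with hC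
    have hBm : MeasurableSet B := (hT n).inter measurableSet_Iic
    have hCm : MeasurableSet C := (hS n).inter hBm
    have hCγ : MeasurableSet[MeasurableSpace.comap γ inferInstance] (γ ⁻¹' C) := ⟨C, hCm, rfl⟩
    obtain ⟨hZi, hZ0⟩ := condExp_indicator_valueAfter_eq_zero hγ hZafter h.vanish_snd
      h.expectation_snd (hσm n).1 (hTσ n) (m : ℝ≥0)
    have hCB : (γ ⁻¹' C).indicator ((γ ⁻¹' B).indicator (valueAfter γ Z)) =
        (γ ⁻¹' C).indicator (valueAfter γ Z) := by
      rw [Set.indicator_indicator, Set.inter_eq_left.2 (Set.preimage_mono Set.inter_subset_right)]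
    have hZC : P[(γ ⁻¹' C).indicator (valueAfter γ Z) | MeasurableSpace.comap γ inferInstance]
        =ᵐ[P] 0 := by
      have h1 := condExp_indicator hZi hCγ
      rw [hCB] at h1
      filter_upwards [h1, hZ0] with ω h1 h2
      rw [h1, Set.indicator_apply_eq_zero.2 fun _ => h2]
      rfl
    have hZCi : Integrable ((γ ⁻¹' C).indicator (valueAfter γ Z)) P := by
      rw [← hCB]; exact hZi.indicator (hγ hCm)
    have hXCi : Integrable ((γ ⁻¹' C).indicator (valueAfter γ X)) P := by
      refine ((((hτm n).1.integrable (m : ℝ≥0)).indicator (hγ hCm))).congr ?_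
      filter_upwards [hXafter] with ω hω
      by_cases hωC : ω ∈ γ ⁻¹' C
      · obtain ⟨r, hr, hXr⟩ := exists_stoppedProcess_eq (τ n) (m : ℝ≥0) ω
        rw [Set.indicator_of_mem hωC, Set.indicator_of_mem hωC, hXr, hω]
        rw [hr]
        exact le_min hωC.2.2 ((hSτ n ω).2 hωC.1)
      · rw [Set.indicator_of_notMem hωC, Set.indicator_of_notMem hωC]
    have hYC : (γ ⁻¹' C).indicator (valueAfter γ Y) =ᵐ[P]
        (γ ⁻¹' C).indicator (valueAfter γ X) - (γ ⁻¹' C).indicator (valueAfter γ Z) := by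
      filter_upwards [hsum] with ω hω
      by_cases hωC : ω ∈ γ ⁻¹' C
      · simp only [Pi.sub_apply, Set.indicator_of_mem hωC, hω, add_sub_cancel_right]
      · simp only [Pi.sub_apply, Set.indicator_of_notMem hωC, sub_zero]
    have hYCi := (hXCi.sub hZCi).congr hYC.symm
    have h1 := condExp_congr_ae (m := MeasurableSpace.comap γ inferInstance) hYC
    -- Adaptedness of `Y` to the smallest filtration enters here: its terminal value is
    -- `σ(γ)`-measurable.
    rw [condExp_of_stronglyMeasurable hγ.comap_le (hLY.stronglyMeasurable.indicator hCγ) hYCi] at h1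
    filter_upwards [h1, condExp_sub hXCi hZCi (MeasurableSpace.comap γ inferInstance), hZC,
      condExp_indicator_preimage hγ hLX hCm hXCi] with ω e1 e2 e3 e4 hωS hωT hωm
    have hωC : ω ∈ γ ⁻¹' C := ⟨hωS, hωT, hωm⟩
    rw [e2, Pi.sub_apply, e3, e4, Set.indicator_of_mem hωC, Set.indicator_of_mem hωC] at e1
    simpa using e1
  filter_upwards [hmean, hYafter, h.vanish_snd, h.sum_eq,
    ae_exists_lt_of_isLocalizingSequence hτ, ae_exists_lt_of_isLocalizingSequence hσ]
    with ω hmean hY hZ hs hτlim hσlim t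
  rcases le_or_gt (γ ω) t with ht | ht
  · obtain ⟨n, hn1, hn2⟩ := ((hτlim t).and (hσlim t)).exists
    rw [meanPart, if_pos ht, hY t ht]
    refine hmean n ⌈t⌉₊ ((hSτ n ω).1 (ht.trans hn1.le)) ((hTσ n ω).1 (ht.trans hn2.le)) ?_
    exact ht.trans (ENNReal.coe_le_coe.2 (Nat.le_ceil t))
  · rw [meanPart, if_neg (not_le.2 ht), hs t, Pi.add_apply, Pi.add_apply, hZ t ht, add_zero]

end Uniqueness

end SingleJump

/-- Existence is asserted with `M = M' + M''` and the vanishing of `M''` on `{t < γ}` holding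
everywhere; uniqueness is up to indistinguishability, among all decompositions in which these two
properties hold only up to evanescent sets. -/
theorem corollary1 {Ω : Type*} {mΩ : MeasurableSpace Ω} (P : Measure Ω) [IsProbabilityMeasure P]
    (γ : Ω → ℝ≥0∞) (hγ : Measurable γ) (hγ_pos : 0 < P {ω | 0 < γ ω})
    (M : ℝ≥0 → Ω → ℝ)
    (hM : SingleJump.IsLocalMartingale M (SingleJump.singleJumpFiltration γ) P) :
    ∃ M' M'' : ℝ≥0 → Ω → ℝ,
      SingleJump.IsDecomposition P γ M M' M'' ∧
      (∀ t ω, M t ω = M' t ω + M'' t ω) ∧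
      (∀ (t : ℝ≥0) (ω : Ω), (t : ℝ≥0∞) < γ ω → M'' t ω = 0) ∧
      ∀ N' N'' : ℝ≥0 → Ω → ℝ, SingleJump.IsDecomposition P γ M N' N'' →
        SingleJump.Indistinguishable P N' M' ∧ SingleJump.Indistinguishable P N'' M'' := by
  refine ⟨SingleJump.meanPart P γ M, M - SingleJump.meanPart P γ M,
    SingleJump.isDecomposition_meanPart hγ hM, fun t ω => by simp, fun t ω h => ?_,
    fun N' N'' hN => ?_⟩
  · simp [SingleJump.meanPart, not_le.2 h]
  · have h1 := hN.indistinguishable_meanPart hγ hM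
    refine ⟨h1, ?_⟩
    filter_upwards [h1, hN.sum_eq] with ω h1 h2 t
    have h3 := h2 t
    rw [Pi.add_apply, Pi.add_apply] at h3
    rw [Pi.sub_apply, Pi.sub_apply, ← h1 t, h3, add_sub_cancel_left]
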